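/- **Setting.** Let $K,N\in\mathbb N$. Let $z_1,\dots,z_N\in\mathbb R^2$ (landmarks), $B_{ki}\in\mathbb R^3$ for $1\le k\le K$, $1\le i\le N$ (points of the basis shapes), weights $w_i\ge 0$ with $\sum_i w_i>0$, constants $s_x,s_y,\alpha\in\mathbb R$, and $\Pi=\begin{pmatrix}s_x&0&0\\0&s_y&0\end{pmatrix}$. Put $$\tilde z_i=\sqrt{w_i}\Big(z_i-\tfrac{\sum_j w_jz_j}{\sum_j w_j}\Big),\qquad \tilde B_{ki}=\sqrt{w_i}\Big(B_{ki}-\tfrac{\sum_j w_jB_{kj}}{\sum_j w_j}\Big),$$ $$f(c,R)=\sum_{i=1}^N\Big\|\tilde z_i-\Pi R\Big(\sum_{k=1}^K c_k\tilde B_{ki}\Big)\Big\|^2+\alpha\sum_{k=1}^K|c_k| .$$ The *translation-free shape reconstruction problem* is $$\min f(c,R)\quad\text{subject to } c_k\ge 0\ (k=1,\dots,K),\ R\in \mathrm{SO}(3), \tag{P}$$ and its *normalized* version, with bounded coefficients, is $$\min f(c,R)\quad\text{subject to } 0\le c_k\le 1\ (k=1,\dots,K),\ R\in \mathrm{SO}(3).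 \tag{P$_1$}$$ Let $x=(c,r)\in\mathbb R^{K+9}$, where $r$ consists of the entries of $R$, with columns $r_1,r_2,r_3$. Regard $f$ as a polynomial in $x$ (with $\sum_k c_k$ in place of $\sum_k|c_k|$). Let $g_k=c_k$ and $g_{K+k}=1-c_k^2$ for $1\le k\le K$, and let $h_1,\dots,h_{15}$ be the quadratic polynomials $1-\|r_1\|^2$, $1-\|r_2\|^2$, $1-\|r_3\|^2$, $r_1^{\mathsf T}r_2$, $r_2^{\mathsf T}r_3$, $r_3^{\mathsf T}r_1$ and the components of $r_1\times r_2-r_3$, $r_2\times r_3-r_1$, $r_3\times r_1-r_2$. Let $[x]_d$ be the vector of all monomials in $x$ of degree at most $d$. For $\beta\ge 2$, the *order-$\beta$ SOS semidefinite program* is $$\max\ \gamma\quad\text{s.t.}\quad f-\gamma=[x]_\beta^{\mathsf T}S_0[x]_\beta+\sum_{k=1}^{2K}\big([x]_{\beta-1}^{\mathsf T}S_k[x]_{\beta-1}\big)g_k+\sum_{i=1}^{15}\big(\lambda_i^{\mathsf T}[x]_{2\beta-2}\big)h_i$$ as polynomials, over $\gamma\in\mathbb R$, symmetric positive semidefinite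 matrices $S_0,\dots,S_{2K}$ and real vectors $\lambda_1,\dots,\lambda_{15}$. *Rounding.* Given $S_0$, take an eigenvector $v$ for the smallest eigenvalue of $S_0$, scaled so that its entry at the monomial $1$ is $1$. Let $\hat c_k$ be the entry of $v$ at $c_k$, clipped to $[0,1]$, and let $\hat R$ be a Frobenius-nearest element of $\mathrm{SO}(3)$ to the matrix of entries of $v$ at the variables $r$. For the rounded point $\hat x=(\hat c,\hat R)$ put $\hat f_\beta=f(\hat x)$ and $\eta_\beta=(\hat f_\beta-f^\star_\beta)/\hat f_\beta$ (with $0/0=0$), where $f^\star_\beta$ is the optimal value of the program. **Theorem (Certificate of Global Optimality).** Let $\beta\ge2$ and let $(\gamma^\star,S_0^{\beta\star},(S_k^{\beta\star})_k,(\lambda_i^{\beta\star})_i)$ be an optimal solution of the order-$\beta$ SOS semidefinite program, $f^\star_\beta=\gamma^\star$. Suppose that $\operatorname{corank}(S_0^{\beta\star})=\dim\ker S_0^{\beta\star}=1$. Then: 1. $f^\star_\beta$ is the global minimum of (P$_1$), and it is attained. 2. Every eigenvector of $S_0^{\beta\star}$ for its smallest eigenvalue has a nonzero entry at the monomial $1$,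 and the rounding yields exactly one point $\hat x$. 3. $\hat f_\beta=f^\star_\beta$ and $\eta_\beta=0$. 4. $\hat x$ is the unique global minimizer of (P$_1$). 5. If (P) has a global minimizer with all $c_k\le1$, then $f^\star_\beta$ is also the global minimum of (P) and $\hat x$ is a global minimizer of (P). If moreover every global minimizer of (P) satisfies $c_k\le 1$ for all $k$, then $\hat x$ is the unique global minimizer of (P). -/

import Mathlib

open scoped Matrix

noncomputable section

namespace ShapeRecon

/-! ### Problem data and the translation-free objective -/

/-- Data of a weighted shape reconstruction problem: `N` landmarks `z i` in the plane, `K` basis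
shapes with points `B k i` in space, weights `w i`, the two constants of the weak perspective
projection and the regularization constant. -/
structure Data (K N : ℕ) where
  z : Fin N → EuclideanSpace ℝ (Fin 2)
  B : Fin K → Fin N → EuclideanSpace ℝ (Fin 3)
  w : Fin N → ℝ
  sx : ℝ
  sy : ℝ
  α : ℝ
  w_nonneg : ∀ i, 0 ≤ w i
  w_sum_pos : 0 < ∑ i, w i

/-- A candidate solution: shape coefficients and a `3 × 3` matrix. -/
abbrev Point (K : ℕ) : Type := (Fin K → ℝ) × Matrix (Fin 3) (Fin 3) ℝ

namespace Data

variable {K N : ℕ} (D : Data K N)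

/-- Weak perspective projection matrix. -/
def proj : Matrix (Fin 2) (Fin 3) ℝ := !![D.sx, 0, 0; 0, D.sy, 0]

/-- Weighted centroid of the landmarks. -/
def zBar : EuclideanSpace ℝ (Fin 2) := (∑ i, D.w i)⁻¹ • ∑ i, D.w i • D.z i

/-- Weighted centroid of the `k`-th basis shape. -/
def bBar (k : Fin K) : EuclideanSpace ℝ (Fin 3) := (∑ i, D.w i)⁻¹ • ∑ i, D.w i • D.B k i

/-- Centered and weighted landmarks. -/
def zTilde (i : Fin N) : EuclideanSpace ℝ (Fin 2) := √(D.w i) • (D.z i - D.zBar)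

/-- Centered and weighted basis shapes. -/
def bTilde (k : Fin K) (i : Fin N) : EuclideanSpace ℝ (Fin 3) :=
  √(D.w i) • (D.B k i - D.bBar k)

/-- The translation-free objective
`∑ᵢ ‖z̃ᵢ - Π R (∑ₖ cₖ B̃ₖᵢ)‖² + α ∑ₖ |cₖ|`, with Euclidean norms. -/
def objective (x : Point K) : ℝ :=
  ∑ i, ‖D.zTilde i -
      WithLp.toLp 2 (D.proj *ᵥ (x.2 *ᵥ (∑ k, x.1 k • D.bTilde k i).ofLp))‖ ^ 2
    + D.α * ∑ k, |x.1 k|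

end Data

/-- Feasible set of the translation-free problem: `cₖ ≥ 0` and `R ∈ SO(3)`. -/
def feasible (K : ℕ) : Set (Point K) :=
  {x | (∀ k, 0 ≤ x.1 k) ∧ x.2 ∈ Matrix.specialOrthogonalGroup (Fin 3) ℝ}

/-- Feasible set of the normalized translation-free problem: in addition `cₖ ≤ 1`. -/
def feasibleNormalized (K : ℕ) : Set (Point K) :=
  {x | x ∈ feasible K ∧ ∀ k, x.1 k ≤ 1}

/-- `x` is a global minimizer of `f` over `X`. -/
def IsGlobalMinimizer {E : Type*} (f : E → ℝ) (X : Set E) (x : E) : Prop :=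
  x ∈ X ∧ ∀ y ∈ X, f x ≤ f y

/-- `x` is the unique global minimizer of `f` over `X`. -/
def IsUniqueGlobalMinimizer {E : Type*} (f : E → ℝ) (X : Set E) (x : E) : Prop :=
  IsGlobalMinimizer f X x ∧ ∀ y, IsGlobalMinimizer f X y → y = x

/-! ### The polynomial formulation -/

/-- The `K + 9` variables: the coefficients `cₖ` and the entries `R a b` of the matrix. -/
abbrev Var (K : ℕ) : Type := Fin K ⊕ (Fin 3 × Fin 3)

/-- Polynomials in the `K + 9` variables. -/
abbrev Poly (K : ℕ) : Type := MvPolynomial (Var K) ℝ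

/-- The variable `cₖ`. -/
def cVar {K : ℕ} (k : Fin K) : Poly K := MvPolynomial.X (Sum.inl k)

/-- The variable `R a b`. -/
def rVar {K : ℕ} (a b : Fin 3) : Poly K := MvPolynomial.X (Sum.inr (a, b))

/-- The `b`-th column of the matrix of variables. -/
def rCol (K : ℕ) (b : Fin 3) : Fin 3 → Poly K := fun a => rVar a b

/-- The objective as a polynomial; the `ℓ¹` term is `α ∑ₖ cₖ`, as the `cₖ` are nonnegative. -/
def fPoly {K N : ℕ} (D : Data K N) : Poly K :=
  ∑ i, ∑ a : Fin 2, (MvPolynomial.C (D.zTilde i a) -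
      ∑ b : Fin 3, MvPolynomial.C (D.proj a b) *
        ∑ d : Fin 3, rVar b d * ∑ k, cVar k * MvPolynomial.C (D.bTilde k i d)) ^ 2
    + MvPolynomial.C D.α * ∑ k, cVar k

/-- The `2K` inequality constraints `cₖ ≥ 0` and `1 - cₖ² ≥ 0`. -/
def gPoly {K : ℕ} : Fin K ⊕ Fin K → Poly K
  | Sum.inl k => cVar k
  | Sum.inr k => 1 - cVar k ^ 2

/-- The `15` quadratic equality constraints describing `SO(3)`. -/
def hPoly (K : ℕ) : Fin 15 → Poly K :=
  ![1 - rCol K 0 ⬝ᵥ rCol K 0,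
    1 - rCol K 1 ⬝ᵥ rCol K 1,
    1 - rCol K 2 ⬝ᵥ rCol K 2,
    rCol K 0 ⬝ᵥ rCol K 1,
    rCol K 1 ⬝ᵥ rCol K 2,
    rCol K 2 ⬝ᵥ rCol K 0,
    (crossProduct (rCol K 0) (rCol K 1) - rCol K 2) 0,
    (crossProduct (rCol K 0) (rCol K 1) - rCol K 2) 1,
    (crossProduct (rCol K 0) (rCol K 1) - rCol K 2) 2,
    (crossProduct (rCol K 1) (rCol K 2) - rCol K 0) 0,
    (crossProduct (rCol K 1) (rCol K 2) - rCol K 0) 1,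
    (crossProduct (rCol K 1) (rCol K 2) - rCol K 0) 2,
    (crossProduct (rCol K 2) (rCol K 0) - rCol K 1) 0,
    (crossProduct (rCol K 2) (rCol K 0) - rCol K 1) 1,
    (crossProduct (rCol K 2) (rCol K 0) - rCol K 1) 2]

/-! ### The order-`β` sums-of-squares semidefinite program -/

/-- Index set of the vector `[x]_d` of all monomials of degree at most `d`. -/
abbrev Mono (K d : ℕ) : Type := {e : Var K →₀ ℕ // e.degree ≤ d}

instance (K d : ℕ) : Finite (Mono K d) :=
  Set.Finite.to_subtype (Finsupp.finite_of_degree_le d)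

instance (K d : ℕ) : Fintype (Mono K d) := Fintype.ofFinite _

instance (K d : ℕ) : DecidableEq (Mono K d) := Classical.decEq _

/-- The vector `[x]_d`. -/
def monoVec (K d : ℕ) : Mono K d → Poly K := fun e => MvPolynomial.monomial e.1 1

/-- The polynomial `[x]_dᵀ S [x]_d`. -/
def gramPoly {K d : ℕ} (S : Matrix (Mono K d) (Mono K d) ℝ) : Poly K :=
  monoVec K d ⬝ᵥ (S.map MvPolynomial.C *ᵥ monoVec K d)

/-- The polynomial `lᵀ [x]_d`. -/
def linPoly {K d : ℕ} (l : Mono K d → ℝ) : Poly K :=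
  (fun e => MvPolynomial.C (l e)) ⬝ᵥ monoVec K d

/-- The decision variables `γ, S₀, S₁, …, S₂ₖ, λ₁, …, λ₁₅`. -/
structure SDPVar (K β : ℕ) where
  γ : ℝ
  S₀ : Matrix (Mono K β) (Mono K β) ℝ
  S : Fin K ⊕ Fin K → Matrix (Mono K (β - 1)) (Mono K (β - 1)) ℝ
  lam : Fin 15 → Mono K (2 * β - 2) → ℝ

/-- Feasibility for the semidefinite program. -/
structure SDPFeasible {K N β : ℕ} (D : Data K N) (p : SDPVar K β) : Prop where
  psd₀ : p.S₀.PosSemidef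
  psd : ∀ k, (p.S k).PosSemidef
  identity : fPoly D - MvPolynomial.C p.γ =
    gramPoly p.S₀ + ∑ k, gramPoly (p.S k) * gPoly k + ∑ i, linPoly (p.lam i) * hPoly K i

/-- Optimality for the semidefinite program: `γ` is maximal among feasible points. -/
def SDPOptimal {K N β : ℕ} (D : Data K N) (p : SDPVar K β) : Prop :=
  SDPFeasible D p ∧ ∀ q : SDPVar K β, SDPFeasible D q → q.γ ≤ p.γ

/-- The dimension of the null space of a square matrix. -/
def corank {n : Type*} [Fintype n] [DecidableEq n] (S : Matrix n n ℝ) : ℕ :=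
  Module.finrank ℝ (LinearMap.ker (Matrix.toLin' S))

/-! ### Rounding and the relative duality gap -/

/-- `v` is an eigenvector of `S` for the smallest eigenvalue of `S`. -/
def IsMinEigenvector {n : Type*} [Fintype n] [DecidableEq n] (S : Matrix n n ℝ) (v : n → ℝ) :
    Prop :=
  ∃ μ : ℝ, Module.End.HasEigenvector (Matrix.toLin' S) μ v ∧
    ∀ ν : ℝ, Module.End.HasEigenvalue (Matrix.toLin' S) ν → μ ≤ ν

/-- `R` is a projection of `A` onto `SO(3)`: a nearest rotation in the Frobenius norm. -/
def IsSO3Projection (A R : Matrix (Fin 3) (Fin 3) ℝ) : Prop :=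
  R ∈ Matrix.specialOrthogonalGroup (Fin 3) ℝ ∧
    ∀ Q ∈ Matrix.specialOrthogonalGroup (Fin 3) ℝ,
      ∑ a, ∑ b, (A a b - R a b) ^ 2 ≤ ∑ a, ∑ b, (A a b - Q a b) ^ 2

/-- The index of the monomial `1` in `[x]_d`. -/
def monoOne (K d : ℕ) : Mono K d := ⟨0, by simp⟩

/-- The index of the degree-one monomial given by the variable `u` in `[x]_d`, for `d ≥ 1`. -/
def monoVar {K d : ℕ} (hd : 1 ≤ d) (u : Var K) : Mono K d :=
  ⟨Finsupp.single u 1, by simpa using hd⟩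

/-- `x` is obtained by rounding from `S₀`: take an eigenvector for the smallest eigenvalue, scale
it so that its entry at the monomial `1` is `1`, clip its entries at the `cₖ` to `[0, 1]`, and
project the matrix of its entries at the `R a b` onto `SO(3)`. -/
def IsRounding {K β : ℕ} (hβ : 1 ≤ β) (S₀ : Matrix (Mono K β) (Mono K β) ℝ) (x : Point K) :
    Prop :=
  ∃ v : Mono K β → ℝ, IsMinEigenvector S₀ v ∧ v (monoOne K β) = 1 ∧
    (∀ k, x.1 k = max 0 (min 1 (v (monoVar hβ (Sum.inl k))))) ∧
    IsSO3Projection (Matrix.of fun a b => v (monoVar hβ (Sum.inr (a, b)))) x.2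

/-- The relative duality gap `(fHat - fStar) / fHat`. -/
def relativeGap (fHat fStar : ℝ) : ℝ := (fHat - fStar) / fHat

end ShapeRecon

end

open scoped Matrix

noncomputable section

namespace ShapeRecon

/-! The argument is conic duality. Evaluating a certificate at a feasible point gives `f ≥ γ` there
(`le_objective`). For the converse a dual optimum is needed, and no Slater point is at hand.
Instead, the bounds `c_k² ≤ 1` and `‖r_b‖² = 1` make the constant `1` an order unit of the
certificate cone among polynomials of degree at most `2β` (`exists_smul_one_add_mem_certCone`). The
M. Riesz extension theorem then yields a functional `L`, nonnegative on the cone, with `L 1 = 1` and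
`L (f - γ) = 0` (`exists_moment_functional`).

Complementary slackness says that `S₀` annihilates every column of the moment matrix of `L`
(`mulVec_moment_eq_zero`). If `ker S₀` is a line, all columns are multiples of the column at the
monomial `1`. As `L 1 = 1`, the moment matrix is then `m mᵀ`, so `L` is multiplicative and is
evaluation at a point `x` (`eq_eval_of_multiplicative`). Positivity of `L` on the constraints makes
`x` feasible, and `L (f - γ) = 0` gives `f x = γ`.

Conversely, the monomial vector of any feasible point of value `γ` lies in `ker S₀`
(`mulVec_monoValues_eq_zero`). Its entry at `1` is `1`, so it equals that of `x`. This gives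
uniqueness, and it shows that rounding the kernel vector returns `x`. -/

/-! ### A positive functional at the boundary of a cone with an order unit -/

/-- If `e` is an order unit of the cone `Q` and `p₀ ∈ Q` leaves `Q` in the direction `-e`, then some
functional that is nonnegative on `Q` and normalized at `e` vanishes at `p₀`. -/
theorem exists_nonneg_functional_eq_zero {E : Type*} [AddCommGroup E] [Module ℝ E]
    (Q : PointedCone ℝ E) {e p₀ : E} (hunit : ∀ y, ∃ t : ℝ, t • e + y ∈ Q)
    (he : ∀ a : ℝ, a • e ∈ Q → 0 ≤ a) (hp₀ : p₀ ∈ Q)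
    (hopt : ∀ ε : ℝ, p₀ - ε • e ∈ Q → ε ≤ 0) :
    ∃ L : E →ₗ[ℝ] ℝ, L e = 1 ∧ L p₀ = 0 ∧ ∀ x ∈ Q, 0 ≤ L x := by
  have smul_mem : ∀ (c : ℝ) {x : E}, 0 ≤ c → x ∈ Q → c • x ∈ Q := fun c x hc hx =>
    Q.smul_mem hc hx
  -- `Q'` is `Q` enlarged by the whole line through `p₀`: a functional nonnegative on `Q'` must
  -- vanish at `p₀`.
  let Q' : PointedCone ℝ E :=
    { carrier := {q | ∃ t : ℝ, q + t • p₀ ∈ Q}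
      add_mem' := by
        rintro x y ⟨s, hs⟩ ⟨t, ht⟩
        refine ⟨s + t, ?_⟩
        have := Q.add_mem hs ht
        convert this using 1
        module
      zero_mem' := ⟨0, by simp⟩
      smul_mem' := by
        rintro c x ⟨t, ht⟩
        refine ⟨c * t, ?_⟩
        have := smul_mem c c.2 ht
        convert this using 1
        rw [smul_add, smul_smul]
        rfl }
  have mem_Q' : ∀ q, q ∈ Q' ↔ ∃ t : ℝ, q + t • p₀ ∈ Q := fun _ => Iff.rfl
  have hQ' : ∀ a : ℝ, a • e ∈ Q' → 0 ≤ a := by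
    intro a ha
    obtain ⟨t, ht⟩ := (mem_Q' _).1 ha
    rcases le_or_gt t 0 with h | h
    · apply he
      have := Q.add_mem ht (smul_mem (-t) (by linarith) hp₀)
      convert this using 1
      module
    -- Dividing `a • e + t • p₀ ∈ Q` by `t > 0` puts `p₀ + (a / t) • e` in `Q`, and optimality of
    -- `p₀` bounds the coefficient.
    · have h1 := hopt (-(t⁻¹ * a)) (by
        have := smul_mem t⁻¹ (by positivity) ht
        convert this using 1
        rw [smul_add, smul_smul, smul_smul, inv_mul_cancel₀ h.ne']
        module)
      have h2 : 0 ≤ t⁻¹ * a := by linarith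
      exact nonneg_of_mul_nonneg_right h2 (by positivity)
  have he0 : e ≠ 0 := by
    rintro rfl
    have := he (-1) (by simp)
    linarith
  let f : E →ₗ.[ℝ] ℝ := LinearPMap.mkSpanSingleton e 1 he0
  have hf : ∀ a : ℝ, ∀ h : a • e ∈ f.domain, f ⟨a • e, h⟩ = a := by
    intro a h
    have := LinearPMap.mkSpanSingleton'_apply e (1 : ℝ) (fun c hc => by simp_all) a h
    exact this.trans (by simp)
  have hdom : ∀ a : ℝ, a • e ∈ f.domain := fun a =>
    Submodule.mem_span_singleton.2 ⟨a, rfl⟩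
  obtain ⟨L, hL, hpos⟩ := riesz_extension Q' f (by
      rintro ⟨x, hx⟩ hxQ
      obtain ⟨a, rfl⟩ := Submodule.mem_span_singleton.1 hx
      rw [hf]
      exact hQ' a hxQ) (by
      intro y
      obtain ⟨t, ht⟩ := hunit y
      exact ⟨⟨t • e, hdom t⟩, (mem_Q' _).2 ⟨0, by simpa using ht⟩⟩)
  have hpos' : ∀ x, ∀ t : ℝ, x + t • p₀ ∈ Q → 0 ≤ L x := fun x t h => hpos x ⟨t, h⟩
  refine ⟨L, ?_, ?_, fun x hx => hpos' x 0 (by simpa using hx)⟩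
  · have := hL ⟨(1 : ℝ) • e, hdom 1⟩
    rw [hf] at this
    simpa using this
  · have h1 := hpos' p₀ 0 (by simpa using hp₀)
    have h2 := hpos' (-p₀) 1 (by simp)
    rw [map_neg] at h2
    linarith

/-! ### The special orthogonal group in coordinates -/

/-- The value of the variables at a point. -/
def Point.vars {K : ℕ} (x : Point K) : Var K → ℝ :=
  Sum.elim x.1 fun ab => x.2 ab.1 ab.2

theorem eval_hPoly_eq_zero_iff {K : ℕ} (x : Point K) :
    (∀ i, MvPolynomial.eval x.vars (hPoly K i) = 0) ↔
      x.2 ∈ Matrix.specialOrthogonalGroup (Fin 3) ℝ := by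
  obtain ⟨c, R⟩ := x
  rw [Matrix.mem_specialOrthogonalGroup_iff, Matrix.mem_orthogonalGroup_iff']
  constructor
  · intro h
    simp [Fin.forall_fin_succ, hPoly, rCol, rVar, Point.vars, dotProduct, Fin.sum_univ_succ,
      crossProduct] at h
    obtain ⟨h0, h1, h2, h3, h4, h5, h6, h7, h8, -⟩ := h
    constructor
    · ext i j
      fin_cases i <;> fin_cases j <;>
        simp [Matrix.mul_apply, Fin.sum_univ_succ] <;> linarith
    -- `det R = (r₁ × r₂) · r₃ = ‖r₃‖² = 1`; only one of the three cross product identities is used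
    -- in this direction.
    · rw [Matrix.det_fin_three]
      linear_combination R 0 2 * h6 + R 1 2 * h7 + R 2 2 * h8 - h2
  · rintro ⟨h, hdet⟩
    -- For `RᵀR = 1` and `det R = 1` the adjugate is the transpose; entrywise this is the set of
    -- cross product identities.
    have hadj : R.adjugate = Rᵀ := by
      have h1 : Rᵀ * R * R.adjugate = R.adjugate := by rw [h, one_mul]
      rw [mul_assoc, Matrix.mul_adjugate, hdet, one_smul, mul_one] at h1
      exact h1.symm
    rw [Matrix.adjugate_fin_three] at hadj
    simp [← Matrix.ext_iff, Fin.forall_fin_succ, Matrix.mul_apply, Fin.sum_univ_succ] at h hadj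
    simp [Fin.forall_fin_succ, hPoly, rCol, rVar, Point.vars, dotProduct, Fin.sum_univ_succ,
      crossProduct]
    refine ⟨?_, ?_, ?_, ?_, ?_, ?_, ?_, ?_, ?_, ?_, ?_, ?_, ?_, ?_, ?_⟩ <;> linarith

theorem eval_fPoly {K N : ℕ} (D : Data K N) (x : Point K) (hx : ∀ k, 0 ≤ x.1 k) :
    MvPolynomial.eval x.vars (fPoly D) = D.objective x := by
  have habs : ∀ k, |x.1 k| = x.1 k := fun k => abs_of_nonneg (hx k)
  simp only [fPoly, Data.objective, habs, EuclideanSpace.norm_sq_eq, map_add, map_sum, map_mul,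
    map_pow, map_sub, MvPolynomial.eval_C, cVar, rVar, MvPolynomial.eval_X, Point.vars,
    Sum.elim_inl, Sum.elim_inr, PiLp.sub_apply, Matrix.mulVec, dotProduct, Real.norm_eq_abs,
    sq_abs, WithLp.ofLp_sum, WithLp.ofLp_smul, Finset.sum_apply, Pi.smul_apply, smul_eq_mul]

theorem one_mem_feasibleNormalized (K : ℕ) :
    ((0, 1) : Point K) ∈ feasibleNormalized K :=
  ⟨⟨fun _ => le_rfl, one_mem _⟩, fun _ => zero_le_one⟩

theorem eval_gPoly_nonneg_iff {K : ℕ} (x : Point K) :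
    (∀ k, 0 ≤ MvPolynomial.eval x.vars (gPoly k)) ↔ ∀ k, 0 ≤ x.1 k ∧ x.1 k ≤ 1 := by
  simp only [Sum.forall, gPoly, cVar, map_sub, map_one, map_pow, MvPolynomial.eval_X, Point.vars,
    Sum.elim_inl, ← forall_and]
  refine forall_congr' fun k => ⟨fun h => ⟨h.1, by nlinarith⟩, fun h => ⟨h.1, by nlinarith⟩⟩

theorem mem_feasibleNormalized_iff {K : ℕ} (x : Point K) :
    x ∈ feasibleNormalized K ↔ (∀ k, 0 ≤ MvPolynomial.eval x.vars (gPoly k)) ∧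
      ∀ i, MvPolynomial.eval x.vars (hPoly K i) = 0 := by
  rw [eval_gPoly_nonneg_iff, eval_hPoly_eq_zero_iff, forall_and]
  exact ⟨fun h => ⟨⟨h.1.1, h.2⟩, h.1.2⟩, fun h => ⟨⟨h.1.1, h.2⟩, h.1.2⟩⟩

/-! ### Gram polynomials and the truncated quadratic module -/

theorem gramPoly_eq_sum {K d : ℕ} (S : Matrix (Mono K d) (Mono K d) ℝ) :
    gramPoly S = ∑ e, ∑ e', MvPolynomial.monomial (e.1 + e'.1) (S e e') := by
  simp only [gramPoly, monoVec, dotProduct, Matrix.mulVec, Matrix.map_apply, Finset.mul_sum,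
    MvPolynomial.C_mul_monomial, MvPolynomial.monomial_mul, mul_one, one_mul]

theorem linPoly_eq_sum {K d : ℕ} (l : Mono K d → ℝ) :
    linPoly l = ∑ e, MvPolynomial.monomial e.1 (l e) := by
  simp only [linPoly, monoVec, dotProduct, MvPolynomial.C_mul_monomial, mul_one]

theorem gramPoly_add {K d : ℕ} (S T : Matrix (Mono K d) (Mono K d) ℝ) :
    gramPoly (S + T) = gramPoly S + gramPoly T := by
  simp only [gramPoly_eq_sum, Matrix.add_apply, map_add, Finset.sum_add_distrib]

theorem gramPoly_smul {K d : ℕ} (a : ℝ) (S : Matrix (Mono K d) (Mono K d) ℝ) :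
    gramPoly (a • S) = a • gramPoly S := by
  simp only [gramPoly_eq_sum, Matrix.smul_apply, Finset.smul_sum, MvPolynomial.smul_monomial]

@[simp]
theorem gramPoly_zero {K d : ℕ} : gramPoly (0 : Matrix (Mono K d) (Mono K d) ℝ) = 0 := by
  simp [gramPoly_eq_sum]

theorem linPoly_add {K d : ℕ} (l m : Mono K d → ℝ) :
    linPoly (l + m) = linPoly l + linPoly m := by
  simp only [linPoly_eq_sum, Pi.add_apply, map_add, Finset.sum_add_distrib]

theorem linPoly_smul {K d : ℕ} (a : ℝ) (l : Mono K d → ℝ) :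
    linPoly (a • l) = a • linPoly l := by
  simp only [linPoly_eq_sum, Pi.smul_apply, Finset.smul_sum, MvPolynomial.smul_monomial]

@[simp]
theorem linPoly_zero {K d : ℕ} : linPoly (0 : Mono K d → ℝ) = 0 := by
  simp [linPoly_eq_sum]

theorem linPoly_single {K d : ℕ} (e : Mono K d) (a : ℝ) :
    linPoly (Pi.single e a) = MvPolynomial.monomial e.1 a := by
  rw [linPoly_eq_sum, Finset.sum_eq_single e]
  · simp
  · intro b _ hb
    simp [hb]
  · simp

theorem gramPoly_conjTranspose_mul_self {K d : ℕ} {m : Type*} [Fintype m]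
    (A : Matrix m (Mono K d) ℝ) : gramPoly (Aᴴ * A) = ∑ i, linPoly (A.row i) ^ 2 := by
  simp only [Matrix.row_apply, gramPoly_eq_sum, linPoly_eq_sum, sq, Finset.sum_mul_sum, MvPolynomial.monomial_mul,
    Matrix.mul_apply, Matrix.conjTranspose_apply, star_trivial, map_sum]
  rw [Finset.sum_comm_cycle]

theorem gramPoly_vecMulVec {K d : ℕ} (l : Mono K d → ℝ) :
    gramPoly (Matrix.vecMulVec l l) = linPoly l ^ 2 := by
  simp only [gramPoly_eq_sum, linPoly_eq_sum, sq, Finset.sum_mul_sum, MvPolynomial.monomial_mul,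
    Matrix.vecMulVec_apply]

theorem eval_gramPoly {K d : ℕ} (S : Matrix (Mono K d) (Mono K d) ℝ) (ξ : Var K → ℝ) :
    MvPolynomial.eval ξ (gramPoly S) =
      (fun e => MvPolynomial.eval ξ (monoVec K d e)) ⬝ᵥ
        S *ᵥ fun e => MvPolynomial.eval ξ (monoVec K d e) := by
  simp [gramPoly, dotProduct, Matrix.mulVec]

theorem totalDegree_gramPoly_le {K d : ℕ} (S : Matrix (Mono K d) (Mono K d) ℝ) :
    (gramPoly S).totalDegree ≤ 2 * d := by
  rw [gramPoly_eq_sum]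
  refine MvPolynomial.totalDegree_finsetSum_le fun e _ =>
    MvPolynomial.totalDegree_finsetSum_le fun e' _ =>
      (MvPolynomial.totalDegree_monomial_le _ _).trans ?_
  have h1 := e.2
  have h2 := e'.2
  change (e.1 + e'.1).degree ≤ _
  rw [map_add]
  omega

theorem totalDegree_linPoly_le {K d : ℕ} (l : Mono K d → ℝ) :
    (linPoly l).totalDegree ≤ d := by
  rw [linPoly_eq_sum]
  exact MvPolynomial.totalDegree_finsetSum_le fun e _ =>
      (MvPolynomial.totalDegree_monomial_le _ _).trans e.2

theorem totalDegree_gPoly_le {K : ℕ} (k : Fin K ⊕ Fin K) :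
    (gPoly k : Poly K).totalDegree ≤ 2 := by
  rcases k with k | k
  · simp [gPoly, cVar]
  · refine (MvPolynomial.totalDegree_sub _ _).trans (max_le (by simp) ?_)
    exact (MvPolynomial.totalDegree_pow _ _).trans (by simp [cVar])

theorem totalDegree_hPoly_le (K : ℕ) (i : Fin 15) : (hPoly K i).totalDegree ≤ 2 := by
  have hr : ∀ a b : Fin 3, (rVar a b : Poly K) ∈ MvPolynomial.restrictTotalDegree (Var K) ℝ 2 :=
    fun a b => by simp [MvPolynomial.mem_restrictTotalDegree, rVar]
  have hrr : ∀ a b a' b' : Fin 3, (rVar a b * rVar a' b' : Poly K) ∈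
      MvPolynomial.restrictTotalDegree (Var K) ℝ 2 := fun a b a' b' => by
    rw [MvPolynomial.mem_restrictTotalDegree]
    exact (MvPolynomial.totalDegree_mul _ _).trans (by simp [rVar])
  have h1 : (1 : Poly K) ∈ MvPolynomial.restrictTotalDegree (Var K) ℝ 2 := by
    simp [MvPolynomial.mem_restrictTotalDegree]
  have hdot : ∀ b b', rCol K b ⬝ᵥ rCol K b' ∈ MvPolynomial.restrictTotalDegree (Var K) ℝ 2 :=
    fun b b' => Submodule.sum_mem _ fun a _ => hrr _ _ _ _
  have hcross : ∀ b b' b'' a, (crossProduct (rCol K b) (rCol K b') - rCol K b'') a ∈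
      MvPolynomial.restrictTotalDegree (Var K) ℝ 2 := fun b b' b'' a => by
    refine Submodule.sub_mem _ ?_ (hr _ _)
    rw [cross_apply]
    fin_cases a <;> exact Submodule.sub_mem _ (hrr _ _ _ _) (hrr _ _ _ _)
  rw [← MvPolynomial.mem_restrictTotalDegree]
  revert i
  have h1dot := fun b => Submodule.sub_mem _ h1 (hdot b b)
  simp only [hPoly, Fin.forall_fin_succ, Matrix.cons_val_zero, Matrix.cons_val_succ]
  exact ⟨h1dot 0, h1dot 1, h1dot 2, hdot 0 1, hdot 1 2, hdot 2 0, hcross 0 1 2 0, hcross 0 1 2 1,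
    hcross 0 1 2 2, hcross 1 2 0 0, hcross 1 2 0 1, hcross 1 2 0 2, hcross 2 0 1 0,
    hcross 2 0 1 1, hcross 2 0 1 2, fun i => i.elim0⟩

/-- The cone of polynomials that have a sums-of-squares certificate of order `β`. -/
def certCone (K β : ℕ) : PointedCone ℝ (Poly K) where
  carrier := {q | ∃ (S₀ : Matrix (Mono K β) (Mono K β) ℝ)
    (S : Fin K ⊕ Fin K → Matrix (Mono K (β - 1)) (Mono K (β - 1)) ℝ)
    (l : Fin 15 → Mono K (2 * β - 2) → ℝ), S₀.PosSemidef ∧ (∀ k, (S k).PosSemidef) ∧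
      q = gramPoly S₀ + ∑ k, gramPoly (S k) * gPoly k + ∑ i, linPoly (l i) * hPoly K i}
  add_mem' := by
    rintro _ _ ⟨S₀, S, l, h₀, h, rfl⟩ ⟨T₀, T, m, k₀, k, rfl⟩
    refine ⟨S₀ + T₀, S + T, l + m, h₀.add k₀, fun i => (h i).add (k i), ?_⟩
    simp only [gramPoly_add, linPoly_add, Pi.add_apply, add_mul, Finset.sum_add_distrib]
    abel
  zero_mem' := ⟨0, 0, 0, .zero, fun _ => .zero, by simp⟩
  smul_mem' := by
    rintro c _ ⟨S₀, S, l, h₀, h, rfl⟩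
    refine ⟨(c : ℝ) • S₀, fun i => (c : ℝ) • S i, fun i => (c : ℝ) • l i, h₀.smul c.2,
      fun i => (h i).smul c.2, ?_⟩
    change (c : ℝ) • (_ : Poly K) = _
    simp only [gramPoly_smul, linPoly_smul, smul_mul_assoc, smul_add, Finset.smul_sum]

theorem mem_certCone_sub_iff {K N β : ℕ} (D : Data K N) (γ : ℝ) :
    fPoly D - MvPolynomial.C γ ∈ certCone K β ↔ ∃ q : SDPVar K β, SDPFeasible D q ∧ q.γ = γ := by
  constructor
  · rintro ⟨S₀, S, l, h₀, h, heq⟩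
    exact ⟨⟨γ, S₀, S, l⟩, ⟨h₀, h, heq⟩, rfl⟩
  · rintro ⟨q, hq, rfl⟩
    exact ⟨q.S₀, q.S, q.lam, hq.psd₀, hq.psd, hq.identity⟩

theorem gramPoly_mem_certCone {K β : ℕ} {S : Matrix (Mono K β) (Mono K β) ℝ}
    (hS : S.PosSemidef) : gramPoly S ∈ certCone K β :=
  ⟨S, 0, 0, hS, fun _ => .zero, by simp⟩

theorem gramPoly_mul_gPoly_mem_certCone {K β : ℕ}
    {S : Matrix (Mono K (β - 1)) (Mono K (β - 1)) ℝ} (hS : S.PosSemidef) (k : Fin K ⊕ Fin K) :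
    gramPoly S * gPoly k ∈ certCone K β := by
  refine ⟨0, Pi.single k S, 0, .zero, fun k' => ?_, ?_⟩
  · by_cases h : k' = k
    · subst h
      simpa using hS
    · simpa [h] using Matrix.PosSemidef.zero
  · rw [Finset.sum_eq_single k]
    · simp
    · intro b _ hb
      simp [hb]
    · simp

theorem linPoly_mul_hPoly_mem_certCone {K β : ℕ} (l : Mono K (2 * β - 2) → ℝ) (i : Fin 15) :
    linPoly l * hPoly K i ∈ certCone K β := by
  refine ⟨0, 0, Pi.single i l, .zero, fun _ => .zero, ?_⟩
  rw [Finset.sum_eq_single i]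
  · simp
  · intro b _ hb
    simp [hb]
  · simp

theorem linPoly_sq_mem_certCone {K β : ℕ} (l : Mono K β → ℝ) :
    linPoly l ^ 2 ∈ certCone K β := by
  rw [← gramPoly_vecMulVec]
  exact gramPoly_mem_certCone (by simpa using Matrix.posSemidef_vecMulVec_self_star l)

theorem linPoly_sq_mul_gPoly_mem_certCone {K β : ℕ} (l : Mono K (β - 1) → ℝ)
    (k : Fin K ⊕ Fin K) : linPoly l ^ 2 * gPoly k ∈ certCone K β := by
  rw [← gramPoly_vecMulVec]
  exact gramPoly_mul_gPoly_mem_certCone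
    (by simpa using Matrix.posSemidef_vecMulVec_self_star l) k

theorem eval_nonneg_of_mem_certCone {K β : ℕ} {q : Poly K} (hq : q ∈ certCone K β)
    {ξ : Var K → ℝ} (hg : ∀ k, 0 ≤ MvPolynomial.eval ξ (gPoly k))
    (hh : ∀ i, MvPolynomial.eval ξ (hPoly K i) = 0) : 0 ≤ MvPolynomial.eval ξ q := by
  have hgram : ∀ {d : ℕ} {S : Matrix (Mono K d) (Mono K d) ℝ}, S.PosSemidef →
      0 ≤ MvPolynomial.eval ξ (gramPoly S) := fun hS => by
    rw [eval_gramPoly]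
    simpa using hS.dotProduct_mulVec_nonneg _
  obtain ⟨S₀, S, l, h₀, h, rfl⟩ := hq
  simp only [map_add, map_sum, map_mul, hh, mul_zero, Finset.sum_const_zero, add_zero]
  exact add_nonneg (hgram h₀) (Finset.sum_nonneg fun k _ => mul_nonneg (hgram (h k)) (hg k))

/-- The multipliers have degree at most `2 * β - 2` and the constraints degree at most `2`. The
hypothesis `1 ≤ β` keeps the natural number subtraction from truncating. -/
theorem totalDegree_le_of_mem_certCone {K β : ℕ} (hβ : 1 ≤ β) {q : Poly K}
    (hq : q ∈ certCone K β) : q ∈ MvPolynomial.restrictTotalDegree (Var K) ℝ (2 * β) := by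
  obtain ⟨S₀, S, l, h₀, h, rfl⟩ := hq
  refine Submodule.add_mem _ (Submodule.add_mem _ ?_ (Submodule.sum_mem _ fun k _ => ?_))
    (Submodule.sum_mem _ fun i _ => ?_) <;> rw [MvPolynomial.mem_restrictTotalDegree]
  · exact totalDegree_gramPoly_le _
  · have h1 := totalDegree_gramPoly_le (S k)
    have h2 := totalDegree_gPoly_le k
    exact (MvPolynomial.totalDegree_mul _ _).trans (by omega)
  · have h1 := totalDegree_linPoly_le (l i)
    have h2 := totalDegree_hPoly_le K i
    exact (MvPolynomial.totalDegree_mul _ _).trans (by omega)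

/-! ### The constant `1` is an order unit -/

theorem exponent_induction {σ : Type*} {P : (σ →₀ ℕ) → Prop} (zero : P 0)
    (add_single : ∀ e u, P e → P (e + Finsupp.single u 1)) (e : σ →₀ ℕ) : P e := by
  induction hn : e.degree generalizing e with
  | zero => rwa [(Finsupp.degree_eq_zero_iff e).1 hn]
  | succ n ih =>
    have he : e ≠ 0 := by
      rintro rfl
      simp at hn
    obtain ⟨u, hu⟩ := Finsupp.ne_iff.1 he
    have hle : Finsupp.single u 1 ≤ e := by
      rw [Finsupp.single_le_iff]
      exact Nat.one_le_iff_ne_zero.2 hu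
    rw [← tsub_add_cancel_of_le hle] at hn ⊢
    refine add_single _ _ (ih _ ?_)
    simpa using hn

theorem exists_add_of_degree_le {σ : Type*} (e : σ →₀ ℕ) :
    ∀ {a b : ℕ}, e.degree ≤ a + b →
      ∃ f g : σ →₀ ℕ, e = f + g ∧ f.degree ≤ a ∧ g.degree ≤ b := by
  induction e using exponent_induction with
  | zero => exact fun _ => ⟨0, 0, by simp⟩
  | add_single e u ih =>
    intro a b h
    rcases a with _ | a
    · exact ⟨0, _, (zero_add _).symm, by simp, by simpa using h⟩
    · rw [map_add, Finsupp.degree_single] at h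
      obtain ⟨f, g, rfl, hf, hg⟩ := ih (a := a) (b := b) (by omega)
      exact ⟨f + Finsupp.single u 1, g, by abel, by simpa using hf, hg⟩

theorem monomial_add_single_one {K : ℕ} (e : Var K →₀ ℕ) (u : Var K) :
    (MvPolynomial.monomial (e + Finsupp.single u 1) 1 : Poly K) =
      MvPolynomial.monomial e 1 * MvPolynomial.X u := by
  rw [MvPolynomial.X, MvPolynomial.monomial_mul, one_mul]

theorem exists_hPoly_eq_one_sub (K : ℕ) (b : Fin 3) :
    ∃ i, hPoly K i = 1 - ∑ a, rVar a b ^ 2 := by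
  have h : ∀ b, 1 - rCol K b ⬝ᵥ rCol K b = 1 - ∑ a, rVar a b ^ 2 := fun b => by
    simp only [dotProduct, rCol, sq]
  fin_cases b
  · exact ⟨0, h 0⟩
  · exact ⟨1, h 1⟩
  · exact ⟨2, h 2⟩

theorem monomial_sq_mem_certCone {K β : ℕ} {e : Var K →₀ ℕ} (he : e.degree ≤ β) :
    (MvPolynomial.monomial e 1 : Poly K) ^ 2 ∈ certCone K β := by
  rw [← linPoly_single ⟨e, he⟩]
  exact linPoly_sq_mem_certCone _

/-- Variables are added one at a time through `1 - m²u² = (1 - m²) + m²(1 - u²)`. For `u = c_k` the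
factor `1 - u²` is a constraint; for `u = R a b` it is the unit norm constraint of column `b` plus
the squares of the other two entries. -/
theorem one_sub_monomial_sq_mem_certCone {K β : ℕ} (e : Var K →₀ ℕ) (he : e.degree ≤ β) :
    1 - (MvPolynomial.monomial e 1 : Poly K) ^ 2 ∈ certCone K β := by
  induction e using exponent_induction with
  | zero => simp
  | add_single e u ih =>
    have hu : ∀ u' : Var K, (e + Finsupp.single u' 1).degree ≤ β := fun u' => by
      rw [map_add, Finsupp.degree_single] at he ⊢
      exact he
    have hdeg : e.degree ≤ β - 1 := by
      rw [map_add, Finsupp.degree_single] at he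
      omega
    have h1 := ih (hdeg.trans (Nat.sub_le _ _))
    rcases u with k | ⟨a, b⟩
    · have h2 := linPoly_sq_mul_gPoly_mem_certCone (Pi.single ⟨e, hdeg⟩ 1) (Sum.inr k)
      rw [linPoly_single] at h2
      convert add_mem h1 h2 using 1
      rw [monomial_add_single_one, gPoly, cVar]
      ring
    · obtain ⟨i, hi⟩ := exists_hPoly_eq_one_sub K b
      -- The multiplier `m²` has degree at most `2(β - 1)`, exactly what the equality multipliers
      -- allow.
      have h2 := linPoly_mul_hPoly_mem_certCone (β := β) (Pi.single ⟨e + e, by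
        rw [map_add]
        omega⟩ 1) i
      have h3 : ∑ a' ∈ Finset.univ.erase a,
          (MvPolynomial.monomial (e + Finsupp.single (Sum.inr (a', b)) 1) 1 : Poly K) ^ 2 ∈
            certCone K β := sum_mem fun a' _ => monomial_sq_mem_certCone (hu _)
      rw [linPoly_single, hi, ← Finset.add_sum_erase _ _ (Finset.mem_univ a)] at h2
      convert add_mem (add_mem h1 h2) h3 using 1
      have hee : (MvPolynomial.monomial (e + e) 1 : Poly K) = MvPolynomial.monomial e 1 ^ 2 := by
        rw [sq, MvPolynomial.monomial_mul, one_mul]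
      simp only [monomial_add_single_one, mul_pow, ← Finset.mul_sum, rVar, hee]
      ring

/-- Split the monomial as `m n` with both factors of degree at most `β`. For `s² = 1`, `2 + 2smn =
(m + sn)² + (1 - m²) + (1 - n²)`. -/
theorem one_add_smul_monomial_mem_certCone {K β : ℕ} {e : Var K →₀ ℕ} (he : e.degree ≤ 2 * β)
    {s : ℝ} (hs : s ^ 2 = 1) : 1 + s • (MvPolynomial.monomial e 1 : Poly K) ∈ certCone K β := by
  obtain ⟨f, g, rfl, hf, hg⟩ := exists_add_of_degree_le e (he.trans_eq (two_mul β))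
  have h := linPoly_sq_mem_certCone (Pi.single (⟨f, hf⟩ : Mono K β) 1 + s • Pi.single ⟨g, hg⟩ 1)
  rw [linPoly_add, linPoly_smul, linPoly_single, linPoly_single] at h
  have h' := add_mem h (add_mem (one_sub_monomial_sq_mem_certCone f hf)
    (one_sub_monomial_sq_mem_certCone g hg))
  have hhalf := (certCone K β).smul_mem (by norm_num : (0 : ℝ) ≤ 1 / 2) h'
  convert hhalf using 1
  have hfg : (MvPolynomial.monomial (f + g) 1 : Poly K) =
      MvPolynomial.monomial f 1 * MvPolynomial.monomial g 1 := by
    rw [MvPolynomial.monomial_mul, one_mul]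
  have hC : (MvPolynomial.C s : Poly K) ^ 2 = 1 := by rw [← map_pow, hs, map_one]
  have h2 : (MvPolynomial.C (1 / 2) : Poly K) * 2 = 1 := by
    rw [show (2 : Poly K) = MvPolynomial.C 2 from (map_ofNat _ 2).symm, ← map_mul]
    norm_num
  rw [hfg]
  simp only [MvPolynomial.smul_eq_C_mul]
  linear_combination (-(1 + MvPolynomial.C s * (MvPolynomial.monomial f 1 *
    MvPolynomial.monomial g 1) : Poly K)) * h2 -
      MvPolynomial.C (1 / 2) * MvPolynomial.monomial g 1 ^ 2 * hC

theorem exists_smul_one_add_mem_certCone {K β : ℕ} {y : Poly K}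
    (hy : y ∈ MvPolynomial.restrictTotalDegree (Var K) ℝ (2 * β)) :
    ∃ t : ℝ, t • (1 : Poly K) + y ∈ certCone K β := by
  have hmon : ∀ e ∈ y.support, ∃ t : ℝ,
      t • (1 : Poly K) + MvPolynomial.monomial e (y.coeff e) ∈ certCone K β := by
    intro e he
    have hdeg : e.degree ≤ 2 * β :=
      (MvPolynomial.le_totalDegree he).trans ((MvPolynomial.mem_restrictTotalDegree _ _ _).1 hy)
    -- With `s` the sign of the coefficient `a`, the term is absorbed by `|a| + a m = |a| (1 + s
    -- m)`.
    obtain ⟨s, hs, hsa⟩ : ∃ s : ℝ, s ^ 2 = 1 ∧ |y.coeff e| * s = y.coeff e := by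
      rcases le_total 0 (y.coeff e) with h | h
      · exact ⟨1, by norm_num, by rw [abs_of_nonneg h, mul_one]⟩
      · exact ⟨-1, by norm_num, by rw [abs_of_nonpos h]; ring⟩
    refine ⟨|y.coeff e|, ?_⟩
    convert (certCone K β).smul_mem (abs_nonneg (y.coeff e))
      (one_add_smul_monomial_mem_certCone hdeg hs) using 1
    rw [smul_add, smul_smul, hsa, MvPolynomial.smul_monomial, smul_eq_mul, mul_one]
  choose! t ht using hmon
  refine ⟨∑ e ∈ y.support, t e, ?_⟩
  have := sum_mem ht
  rwa [Finset.sum_add_distrib, ← Finset.sum_smul, ← y.as_sum] at this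

/-! ### Moment functionals -/

theorem eval_nonneg_of_mem_feasibleNormalized {K β : ℕ} {q : Poly K} (hq : q ∈ certCone K β)
    {x : Point K} (hx : x ∈ feasibleNormalized K) : 0 ≤ MvPolynomial.eval x.vars q :=
  have h := (mem_feasibleNormalized_iff x).1 hx
  eval_nonneg_of_mem_certCone hq h.1 h.2

/-- Strong duality: at an optimal solution of the semidefinite program there is an optimal
pseudo-expectation. -/
theorem exists_moment_functional {K N β : ℕ} (hβ : 1 ≤ β) {D : Data K N} {p : SDPVar K β}
    (hp : SDPOptimal D p) :
    ∃ L : Poly K →ₗ[ℝ] ℝ, L 1 = 1 ∧ L (fPoly D - MvPolynomial.C p.γ) = 0 ∧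
      ∀ q ∈ certCone K β, 0 ≤ L q := by
  -- Separation takes place in degree at most `2β`, where `1` is shown to be an order unit. The cone
  -- lies in `U`, so any linear extension of the functional to all polynomials keeps its positivity.
  set U := MvPolynomial.restrictTotalDegree (Var K) ℝ (2 * β)
  have hU : ∀ q ∈ certCone K β, q ∈ U := fun q hq => totalDegree_le_of_mem_certCone hβ hq
  have h1U : (1 : Poly K) ∈ U := by simp [U, MvPolynomial.mem_restrictTotalDegree]
  have hpQ : fPoly D - MvPolynomial.C p.γ ∈ certCone K β :=
    (mem_certCone_sub_iff D p.γ).2 ⟨p, hp.1, rfl⟩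
  obtain ⟨L, hL1, hLp, hLQ⟩ := exists_nonneg_functional_eq_zero
    (PointedCone.comap U.subtype (certCone K β)) (e := ⟨1, h1U⟩) (p₀ := ⟨_, hU _ hpQ⟩)
    (fun y => exists_smul_one_add_mem_certCone y.2)
    (fun a ha => by
      -- Evaluation at the feasible point `c = 0`, `R = 1` keeps negative constants out of the cone.
      simpa using eval_nonneg_of_mem_feasibleNormalized (PointedCone.mem_comap.1 ha)
        (one_mem_feasibleNormalized K))
    hpQ
    (fun ε h => by
      have h' : fPoly D - MvPolynomial.C (p.γ + ε) ∈ certCone K β := by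
        convert PointedCone.mem_comap.1 h using 1
        simp [MvPolynomial.smul_eq_C_mul, sub_sub]
      obtain ⟨q, hq, hqγ⟩ := (mem_certCone_sub_iff D _).1 h'
      have := hp.2 q hq
      linarith)
  obtain ⟨L', hL'⟩ := L.exists_extend
  have hext : ∀ q (h : q ∈ U), L' q = L ⟨q, h⟩ := fun q h => LinearMap.congr_fun hL' ⟨q, h⟩
  exact ⟨L', by rw [hext _ h1U, hL1], by rw [hext _ (hU _ hpQ), hLp],
    fun q hq => by rw [hext _ (hU q hq)]; exact hLQ _ hq⟩

/-- Complementary slackness: the Gram matrix annihilates the moment matrix. -/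
theorem mulVec_moment_eq_zero {K β : ℕ} {L : Poly K →ₗ[ℝ] ℝ}
    (hL : ∀ q ∈ certCone K β, 0 ≤ L q) {S : Matrix (Mono K β) (Mono K β) ℝ}
    (hS : S.PosSemidef) (h0 : L (gramPoly S) = 0) (e' : Mono K β) :
    (S *ᵥ fun e => L (MvPolynomial.monomial (e.1 + e'.1) 1)) = 0 := by
  open scoped MatrixOrder in
  obtain ⟨A, rfl⟩ := CStarAlgebra.nonneg_iff_eq_star_mul_self.mp hS.nonneg
  rw [Matrix.star_eq_conjTranspose] at h0 ⊢
  rw [gramPoly_conjTranspose_mul_self, map_sum,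
    Finset.sum_eq_zero_iff_of_nonneg fun i _ => hL _ (linPoly_sq_mem_certCone _)] at h0
  -- Cauchy–Schwarz for `L`: since `L (l²) = 0`, the expression `L ((t l + m)²)` is affine in `t`
  -- and nonnegative for all `t`, so its slope `2 L (l m)` is zero.
  have hortho : ∀ i (m : Mono K β → ℝ), L (linPoly (A.row i) * linPoly m) = 0 := by
    intro i m
    set b := L (linPoly (A.row i) * linPoly m)
    set c := L (linPoly m ^ 2)
    have hpos : ∀ t : ℝ, 0 ≤ 2 * t * b + c := by
      intro t
      have h := hL _ (linPoly_sq_mem_certCone (t • A.row i + m))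
      have hexp : linPoly (t • A.row i + m) ^ 2 = t ^ 2 • linPoly (A.row i) ^ 2 +
          ((2 * t) • (linPoly (A.row i) * linPoly m) + linPoly m ^ 2) := by
        rw [linPoly_add, linPoly_smul]
        simp only [MvPolynomial.smul_eq_C_mul, map_mul, map_pow, map_ofNat]
        ring
      rw [hexp, map_add, map_add, map_smul, map_smul, h0 i (Finset.mem_univ i)] at h
      simpa using h
    by_contra hb
    -- At this `t` the affine function would equal `-1`.
    have h := hpos (-(c + 1) / (2 * b))
    have h' : 2 * (-(c + 1) / (2 * b)) * b = -(c + 1) := by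
      field_simp
    linarith
  have hA : (A *ᵥ fun e => L (MvPolynomial.monomial (e.1 + e'.1) 1)) = 0 := by
    ext i
    have h := hortho i (Pi.single e' 1)
    rw [linPoly_single, linPoly_eq_sum, Finset.sum_mul, map_sum] at h
    rw [Pi.zero_apply, ← h]
    refine Finset.sum_congr rfl fun e _ => ?_
    rw [MvPolynomial.monomial_mul, mul_one, ← smul_eq_mul, ← map_smul,
      MvPolynomial.smul_monomial, smul_eq_mul, mul_one]
    rfl
  rw [← Matrix.mulVec_mulVec, hA, Matrix.mulVec_zero]

theorem exists_smul_eq_of_corank_eq_one {n : Type*} [Fintype n] [DecidableEq n]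
    {S : Matrix n n ℝ} (hS : corank S = 1) {v w : n → ℝ} (hv : S *ᵥ v = 0) (hv0 : v ≠ 0)
    (hw : S *ᵥ w = 0) : ∃ c : ℝ, c • v = w := by
  have hmem : ∀ {u}, S *ᵥ u = 0 → u ∈ LinearMap.ker (Matrix.toLin' S) := fun hu => by
    simpa using hu
  obtain ⟨c, hc⟩ := (finrank_eq_one_iff_of_nonzero' (⟨v, hmem hv⟩ : LinearMap.ker _)
    (fun h => hv0 (congrArg Subtype.val h))).1 hS ⟨w, hmem hw⟩
  exact ⟨c, congrArg Subtype.val hc⟩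

/-- A normalized functional whose moment matrix is multiplicative is a point evaluation. -/
theorem eq_eval_of_multiplicative {K β : ℕ} (hβ : 1 ≤ β) {L : Poly K →ₗ[ℝ] ℝ} (h1 : L 1 = 1)
    (hmul : ∀ e e' : Mono K β, L (MvPolynomial.monomial (e.1 + e'.1) 1) =
      L (MvPolynomial.monomial e.1 1) * L (MvPolynomial.monomial e'.1 1)) {q : Poly K}
    (hq : q ∈ MvPolynomial.restrictTotalDegree (Var K) ℝ (2 * β)) :
    L q = MvPolynomial.eval (fun u => L (MvPolynomial.X u)) q := by
  have hhalf : ∀ e : Var K →₀ ℕ, e.degree ≤ β → L (MvPolynomial.monomial e 1) =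
      MvPolynomial.eval (fun u => L (MvPolynomial.X u)) (MvPolynomial.monomial e 1) := by
    intro e
    induction e using exponent_induction with
    | zero => exact fun _ => by rw [← MvPolynomial.one_def, h1, map_one]
    | add_single e u ih =>
      intro he
      have he' : e.degree ≤ β := by
        rw [map_add] at he
        omega
      have hu : L (MvPolynomial.monomial (e + Finsupp.single u 1) 1) =
          L (MvPolynomial.monomial e 1) * L (MvPolynomial.X u) :=
        hmul ⟨e, he'⟩ (monoVar hβ u)
      rw [hu, ih he', monomial_add_single_one, map_mul, MvPolynomial.eval_X]
  rw [q.as_sum, map_sum, map_sum]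
  refine Finset.sum_congr rfl fun e he => ?_
  have hdeg : e.degree ≤ β + β := (MvPolynomial.le_totalDegree he).trans
    (((MvPolynomial.mem_restrictTotalDegree _ _ _).1 hq).trans_eq (two_mul β))
  -- Monomials up to degree `2β` are products of two halves of degree at most `β`, where `hhalf`
  -- applies.
  obtain ⟨f, g, hfg, hf, hg⟩ := exists_add_of_degree_le e hdeg
  have hmon : MvPolynomial.monomial e (q.coeff e) =
      q.coeff e • (MvPolynomial.monomial e 1 : Poly K) := by
    rw [MvPolynomial.smul_monomial, smul_eq_mul, mul_one]
  have hprod : (MvPolynomial.monomial (f + g) 1 : Poly K) =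
      MvPolynomial.monomial f 1 * MvPolynomial.monomial g 1 := by
    rw [MvPolynomial.monomial_mul, one_mul]
  rw [hmon, map_smul, MvPolynomial.smul_eval, smul_eq_mul, hfg, hmul ⟨f, hf⟩ ⟨g, hg⟩, hhalf f hf,
    hhalf g hg, hprod, map_mul]

/-! ### The point recovered from the kernel of the Gram matrix -/

/-- The values of all monomials of degree at most `d` at a point. -/
def Point.monoValues {K : ℕ} (d : ℕ) (x : Point K) : Mono K d → ℝ :=
  fun e => MvPolynomial.eval x.vars (monoVec K d e)

theorem Point.monoValues_monoOne {K d : ℕ} (x : Point K) : x.monoValues d (monoOne K d) = 1 := by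
  simp [Point.monoValues, monoVec, monoOne]

theorem Point.monoValues_monoVar {K d : ℕ} (hd : 1 ≤ d) (x : Point K) (u : Var K) :
    x.monoValues d (monoVar hd u) = x.vars u :=
  MvPolynomial.eval_X u

theorem Point.monoValues_ne_zero {K d : ℕ} (x : Point K) : x.monoValues d ≠ 0 := fun h => by
  have := congrFun h (monoOne K d)
  rw [x.monoValues_monoOne] at this
  exact one_ne_zero this

theorem le_objective {K N β : ℕ} {D : Data K N} {p : SDPVar K β} (hp : SDPFeasible D p)
    {x : Point K} (hx : x ∈ feasibleNormalized K) : p.γ ≤ D.objective x := by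
  have h := eval_nonneg_of_mem_feasibleNormalized ((mem_certCone_sub_iff D p.γ).2 ⟨p, hp, rfl⟩) hx
  rw [map_sub, eval_fPoly D x hx.1.1, MvPolynomial.eval_C] at h
  linarith

/-- At such a point the certificate writes `0` as a sum of nonnegative terms, so the quadratic form
of `S₀` vanishes at the monomial vector; for a positive semidefinite matrix this puts the vector in
the kernel. -/
theorem mulVec_monoValues_eq_zero {K N β : ℕ} {D : Data K N} {p : SDPVar K β}
    (hp : SDPFeasible D p) {x : Point K} (hx : x ∈ feasibleNormalized K)
    (hxγ : D.objective x = p.γ) : p.S₀ *ᵥ x.monoValues β = 0 := by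
  have hid := congrArg (MvPolynomial.eval x.vars) hp.identity
  have hrest := eval_nonneg_of_mem_feasibleNormalized (β := β) (q := ∑ k, gramPoly (p.S k) * gPoly k
    + ∑ i, linPoly (p.lam i) * hPoly K i) (add_mem
      (sum_mem fun k _ => gramPoly_mul_gPoly_mem_certCone (hp.psd k) k)
      (sum_mem fun i _ => linPoly_mul_hPoly_mem_certCone _ i)) hx
  rw [map_sub, eval_fPoly D x hx.1.1, MvPolynomial.eval_C, hxγ, sub_self, add_assoc, map_add,
    eval_gramPoly] at hid
  have hpos := hp.psd₀.dotProduct_mulVec_nonneg (x.monoValues β)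
  rw [← hp.psd₀.dotProduct_mulVec_zero_iff]
  rw [star_trivial] at hpos ⊢
  change 0 = x.monoValues β ⬝ᵥ p.S₀ *ᵥ x.monoValues β + _ at hid
  linarith

theorem exists_point_of_corank_eq_one {K N β : ℕ} (hβ : 1 ≤ β) {D : Data K N} {p : SDPVar K β}
    (hp : SDPOptimal D p) (hcorank : corank p.S₀ = 1) :
    ∃ x ∈ feasibleNormalized K, D.objective x = p.γ := by
  obtain ⟨L, hL1, hLp, hLQ⟩ := exists_moment_functional hβ hp
  have hker : L (gramPoly p.S₀) = 0 := by
    have hrest := hLQ (∑ k, gramPoly (p.S k) * gPoly k + ∑ i, linPoly (p.lam i) * hPoly K i)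
      (add_mem (sum_mem fun k _ => gramPoly_mul_gPoly_mem_certCone (hp.1.psd k) k)
        (sum_mem fun i _ => linPoly_mul_hPoly_mem_certCone _ i))
    have hgram := hLQ _ (gramPoly_mem_certCone hp.1.psd₀)
    rw [hp.1.identity, add_assoc, map_add] at hLp
    linarith
  have hcol := mulVec_moment_eq_zero hLQ hp.1.psd₀ hker
  have hone : (MvPolynomial.monomial (0 : Var K →₀ ℕ) 1 : Poly K) = 1 := rfl
  have hmul : ∀ e e' : Mono K β, L (MvPolynomial.monomial (e.1 + e'.1) 1) =
      L (MvPolynomial.monomial e.1 1) * L (MvPolynomial.monomial e'.1 1) := by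
    intro e e'
    -- Column `e'` of the moment matrix is `c` times the column at `1`, which is nonzero because `L
    -- 1 = 1`. The entry at `1` identifies `c` as the moment of `e'`.
    obtain ⟨c, hc⟩ := exists_smul_eq_of_corank_eq_one hcorank (hcol (monoOne K β))
      (fun h => by
        have := congrFun h (monoOne K β)
        simp [monoOne, hone, hL1] at this) (hcol e')
    have h0 := congrFun hc (monoOne K β)
    have he := congrFun hc e
    simp only [monoOne, Pi.smul_apply, smul_eq_mul, add_zero, zero_add, hone, hL1, mul_one]
      at h0 he
    rw [← he, h0, mul_comm]
  have heval := fun q hq => eq_eval_of_multiplicative hβ hL1 hmul (q := q) hq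
  let x : Point K := (fun k => L (MvPolynomial.X (Sum.inl k)),
    Matrix.of fun a b => L (MvPolynomial.X (Sum.inr (a, b))))
  have hx : x.vars = fun u => L (MvPolynomial.X u) := by
    ext u
    rcases u with k | ⟨a, b⟩ <;> rfl
  rw [← hx] at heval
  have hQeval : ∀ q ∈ certCone K β, L q = MvPolynomial.eval x.vars q := fun q hq =>
    heval q (totalDegree_le_of_mem_certCone hβ hq)
  have hxmem : x ∈ feasibleNormalized K := by
    rw [mem_feasibleNormalized_iff]
    constructor
    · intro k
      have h := linPoly_sq_mul_gPoly_mem_certCone (Pi.single (monoOne K (β - 1)) 1) k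
      rw [linPoly_single, monoOne, hone, one_pow, one_mul] at h
      rw [← hQeval _ h]
      exact hLQ _ h
    · intro i
      -- Equality multipliers are unconstrained in sign, so both `h_i` and `-h_i` lie in the cone.
      have h : ∀ a : ℝ, a • hPoly K i ∈ certCone K β := fun a => by
        have h := linPoly_mul_hPoly_mem_certCone (β := β)
          (a • Pi.single (monoOne K (2 * β - 2)) 1) i
        rwa [linPoly_smul, linPoly_single, monoOne, hone, smul_mul_assoc, one_mul] at h
      have h1 := hLQ _ (h 1)
      have h2 := hLQ _ (h (-1))
      rw [hQeval _ (h _), MvPolynomial.smul_eval] at h1 h2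
      linarith
  refine ⟨x, hxmem, ?_⟩
  rw [hQeval _ ((mem_certCone_sub_iff D p.γ).2 ⟨p, hp.1, rfl⟩), map_sub, eval_fPoly D x hxmem.1.1,
    MvPolynomial.eval_C] at hLp
  linarith

/-! ### Rounding: smallest eigenvectors and projection onto SO(3) -/

theorem IsMinEigenvector.mulVec_eq_zero {n : Type*} [Fintype n] [DecidableEq n]
    {S : Matrix n n ℝ} (hS : S.PosSemidef) {u : n → ℝ} (hu : S *ᵥ u = 0) (hu0 : u ≠ 0)
    {v : n → ℝ} (hv : IsMinEigenvector S v) : S *ᵥ v = 0 := by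
  obtain ⟨μ, hμ, hmin⟩ := hv
  -- The kernel vector `u` makes `0` an eigenvalue, so the smallest one is at most `0`;
  -- semidefiniteness gives the other inequality.
  have hle : μ ≤ 0 := hmin 0 (Module.End.hasEigenvalue_of_hasEigenvector
    (x := u) (Module.End.hasEigenvector_iff.2 ⟨by simpa using hu, hu0⟩))
  have hSv : S *ᵥ v = μ • v := by simpa using hμ.apply_eq_smul
  have hpos := hS.dotProduct_mulVec_nonneg v
  rw [hSv, star_trivial, dotProduct_smul, smul_eq_mul] at hpos
  have hvv : 0 < v ⬝ᵥ v := by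
    simpa using Matrix.dotProduct_star_self_pos_iff.2 hμ.2
  have : μ = 0 := le_antisymm hle (nonneg_of_mul_nonneg_left hpos hvv)
  rw [hSv, this, zero_smul]

theorem isMinEigenvector_of_mulVec_eq_zero {n : Type*} [Fintype n] [DecidableEq n]
    {S : Matrix n n ℝ} (hS : S.PosSemidef) {u : n → ℝ} (hu : S *ᵥ u = 0) (hu0 : u ≠ 0) :
    IsMinEigenvector S u := by
  refine ⟨0, Module.End.hasEigenvector_iff.2 ⟨by simpa using hu, hu0⟩, fun ν hν => ?_⟩
  obtain ⟨v, hv⟩ := hν.exists_hasEigenvector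
  have hSv : S *ᵥ v = ν • v := by simpa using hv.apply_eq_smul
  have hpos := hS.dotProduct_mulVec_nonneg v
  rw [hSv, star_trivial, dotProduct_smul, smul_eq_mul] at hpos
  have hvv : 0 < v ⬝ᵥ v := by
    simpa using Matrix.dotProduct_star_self_pos_iff.2 hv.2
  exact nonneg_of_mul_nonneg_left hpos hvv

/-- A nearest rotation need not be unique for a general matrix, but a rotation is at distance zero
from itself and from no other matrix. -/
theorem isSO3Projection_iff_eq {A R : Matrix (Fin 3) (Fin 3) ℝ}
    (hA : A ∈ Matrix.specialOrthogonalGroup (Fin 3) ℝ) : IsSO3Projection A R ↔ R = A := by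
  constructor
  · rintro ⟨-, h⟩
    have h0 := h A hA
    simp only [sub_self, ne_eq, OfNat.ofNat_ne_zero, not_false_eq_true, zero_pow,
      Finset.sum_const_zero] at h0
    have hsum := le_antisymm h0 (Finset.sum_nonneg fun a _ => Finset.sum_nonneg fun b _ =>
      sq_nonneg (A a b - R a b))
    rw [Finset.sum_eq_zero_iff_of_nonneg fun a _ => Finset.sum_nonneg fun b _ =>
      sq_nonneg (A a b - R a b)] at hsum
    ext a b
    have hb := (Finset.sum_eq_zero_iff_of_nonneg fun b _ => sq_nonneg (A a b - R a b)).1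
      (hsum a (Finset.mem_univ a)) b (Finset.mem_univ b)
    exact (sub_eq_zero.1 (pow_eq_zero_iff two_ne_zero |>.1 hb)).symm
  · rintro rfl
    refine ⟨hA, fun Q _ => ?_⟩
    simp only [sub_self, ne_eq, OfNat.ofNat_ne_zero, not_false_eq_true, zero_pow,
      Finset.sum_const_zero]
    exact Finset.sum_nonneg fun a _ => Finset.sum_nonneg fun b _ => sq_nonneg _

end ShapeRecon

end

/-! ### The certificate of global optimality -/

open ShapeRecon in
theorem mainTheorem1 {K N : ℕ} (D : ShapeRecon.Data K N) (β : ℕ) (hβ : 2 ≤ β)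
    (p : ShapeRecon.SDPVar K β) (hp : ShapeRecon.SDPOptimal D p)
    (hcorank : ShapeRecon.corank p.S₀ = 1) :
    -- tightness
    IsLeast (D.objective '' ShapeRecon.feasibleNormalized K) p.γ ∧
    -- the eigenvector can be normalized
    (∀ v, ShapeRecon.IsMinEigenvector p.S₀ v → v (ShapeRecon.monoOne K β) ≠ 0) ∧
    -- the rounding is well defined, has zero gap and is the unique global minimizer
    ∃ xHat : ShapeRecon.Point K,
      (∀ x, ShapeRecon.IsRounding (one_le_two.trans hβ) p.S₀ x ↔ x = xHat) ∧
      D.objective xHat = p.γ ∧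
      ShapeRecon.relativeGap (D.objective xHat) p.γ = 0 ∧
      ShapeRecon.IsUniqueGlobalMinimizer D.objective (ShapeRecon.feasibleNormalized K) xHat ∧
      -- the same for the problem without upper bounds, when these bounds lose no minimizer
      ((∃ x, ShapeRecon.IsGlobalMinimizer D.objective (ShapeRecon.feasible K) x ∧
          ∀ k, x.1 k ≤ 1) →
        IsLeast (D.objective '' ShapeRecon.feasible K) p.γ ∧
        ShapeRecon.IsGlobalMinimizer D.objective (ShapeRecon.feasible K) xHat ∧
        ((∀ x, ShapeRecon.IsGlobalMinimizer D.objective (ShapeRecon.feasible K) x →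
            ∀ k, x.1 k ≤ 1) →
          ShapeRecon.IsUniqueGlobalMinimizer D.objective (ShapeRecon.feasible K) xHat)) := by
  have hβ1 : 1 ≤ β := one_le_two.trans hβ
  have hfeas := hp.1
  obtain ⟨x, hx, hxγ⟩ := exists_point_of_corank_eq_one hβ1 hp hcorank
  have hker := mulVec_monoValues_eq_zero hfeas hx hxγ
  have hspan : ∀ v, p.S₀ *ᵥ v = 0 → v = v (monoOne K β) • x.monoValues β := fun v hv => by
    obtain ⟨c, rfl⟩ := exists_smul_eq_of_corank_eq_one hcorank hker x.monoValues_ne_zero hv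
    rw [Pi.smul_apply, x.monoValues_monoOne, smul_eq_mul, mul_one]
  have hmin : ∀ v, IsMinEigenvector p.S₀ v → v = v (monoOne K β) • x.monoValues β := fun v hv =>
    hspan v (hv.mulVec_eq_zero hfeas.psd₀ hker x.monoValues_ne_zero)
  have huniq : ∀ y ∈ feasibleNormalized K, D.objective y = p.γ → y = x := fun y hy hyγ => by
    have h := hspan _ (mulVec_monoValues_eq_zero hfeas hy hyγ)
    rw [y.monoValues_monoOne, one_smul] at h
    have hvars : ∀ u, y.vars u = x.vars u := fun u => by
      rw [← Point.monoValues_monoVar hβ1, h, Point.monoValues_monoVar]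
    exact Prod.ext (funext fun k => hvars (Sum.inl k))
      (Matrix.ext fun a b => hvars (Sum.inr (a, b)))
  have hleast : IsLeast (D.objective '' feasibleNormalized K) p.γ :=
    ⟨⟨x, hx, hxγ⟩, by
      rintro _ ⟨y, hy, rfl⟩
      exact le_objective hfeas hy⟩
  have hclip : ∀ k, x.1 k = max 0 (min 1 (x.1 k)) := fun k => by
    rw [min_eq_right (hx.2 k), max_eq_right (hx.1.1 k)]
  refine ⟨hleast, fun v hv h0 => ?_, x, fun y => ⟨?_, ?_⟩, hxγ, by simp [relativeGap, hxγ],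
    ⟨⟨hx, fun y hy => hxγ.trans_le (le_objective hfeas hy)⟩,
      fun y hy => huniq y hy.1 (le_antisymm ((hy.2 x hx).trans_eq hxγ)
        (le_objective hfeas hy.1))⟩, ?_⟩
  · have h := hmin v hv
    rw [h0, zero_smul] at h
    obtain ⟨μ, hμ, -⟩ := hv
    exact hμ.2 h
  · rintro ⟨v, hv, hv1, hc, hR⟩
    have h := hmin v hv
    rw [hv1, one_smul] at h
    -- The normalized eigenvector is the monomial vector of `x`, whose entries already satisfy the
    -- bounds and form a rotation, so clipping and projection change nothing.
    subst h
    simp only [Point.monoValues_monoVar] at hc hR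
    exact Prod.ext (funext fun k => (hc k).trans (hclip k).symm)
      ((isSO3Projection_iff_eq hx.1.2).1 hR)
  · rintro rfl
    refine ⟨y.monoValues β,
      isMinEigenvector_of_mulVec_eq_zero hfeas.psd₀ hker y.monoValues_ne_zero,
      y.monoValues_monoOne, ?_, ?_⟩
    · simp only [Point.monoValues_monoVar]
      exact hclip
    · simp only [Point.monoValues_monoVar]
      exact (isSO3Projection_iff_eq hx.1.2).2 rfl
  · rintro ⟨y, hy, hy1⟩
    -- The minimizer `y` of the unbounded problem is feasible for the bounded one, so its value is
    -- at least `γ`, which `x` attains.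
    have hγy : p.γ ≤ D.objective y := le_objective hfeas ⟨hy.1, hy1⟩
    have hxmin : IsGlobalMinimizer D.objective (feasible K) x :=
      ⟨hx.1, fun y' hy' => (hxγ.trans_le hγy).trans (hy.2 y' hy')⟩
    refine ⟨⟨⟨x, hx.1, hxγ⟩, ?_⟩, hxmin, fun hall => ⟨hxmin, fun y' hy' => ?_⟩⟩
    · rintro _ ⟨y', hy', rfl⟩
      exact hγy.trans (hy.2 y' hy')
    · exact huniq y' ⟨hy'.1, hall y' hy'⟩ (le_antisymm ((hy'.2 x hx.1).trans_eq hxγ)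
        (le_objective hfeas ⟨hy'.1, hall y' hy'⟩))
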